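/- Theorem. Let $B\ge 0$ and $T\ge B+2$ be integers. A streaming code of delay $T$ with source packets in $\mathbb F_q^k$ and channel packets in $\mathbb F_q^n$ consists of encoding functions, $x[i]=f_i(s[0],\dots,s[i])\in\mathbb F_q^n$ for source packets $s[j]\in\mathbb F_q^k$, and decoding functions $g_i$; its rate is $k/n$. For a set $E\subseteq\{0,1,2,\dots\}$ of erased times, the channel output is $y[i]=\star$ if $i\in E$ and $y[i]=x[i]$ otherwise; the packet with index $i$ is recovered with delay $T$ if $g_i(y[0],\dots,y[i+T])=s[i]$ for every source stream $s$. The channel $\mathcal C_{\rm II}(B,W)$ allows exactly those $E$ for which, in every window of $W$ consecutive times, the erasures consist of a single burst of at most $B$ consecutive erasures plus at most one further (isolated) erasure. An isolated erasure is associated with a burst if it occurs within the $T$ times before or the $T$ times after the burst; here a burst means a nonempty run of at most $B$ consecutive erasures that is not contained in a longer such run. Then there exist a finite field $\mathbb F_q$, integers $k,n$ with $$\frac kn=\max_{B<\Delta<T}\ \frac{\Delta(T-\Delta)+(B+1)}{\Delta(T-\Delta)+(B+1)(T-\Delta+2)}\qquad(\Delta\in\mathbb Z),$$ and a streaming code of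 delay $T$ with source packets in $\mathbb F_q^k$ and channel packets in $\mathbb F_q^n$ that is a partial recovery code for $\mathcal C_{\rm II}(B,2T+B)$: for every erasure set $E$ allowed by $\mathcal C_{\rm II}(B,2T+B)$, among the source packets of each erasure burst together with its associated isolated erasure all but at most one are recovered with delay $T$, and every source packet that belongs to no such pair of a burst and an associated erasure is recovered with delay $T$. -/

import Mathlib

/-- The channel `C_II(B, W)`, described by the set `E` of erased time instants: in every window of
`W` consecutive instants the erasures form one burst (a run of consecutive erasures) of length at
most `B` plus at most one isolated erasure. -/
def ChannelII (B W : ℕ) (E : Set ℕ) : Prop :=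
  ∀ i : ℕ, ∃ a b : ℕ, ∃ I : Set ℕ, b ≤ B ∧ I.Subsingleton ∧
    E ∩ Set.Ico i (i + W) = Set.Ico a (a + b) ∪ I

/-- A streaming erasure code of delay `T`, with source packets in `S` and channel packets in `X`:
the packet sent at time `i` is a function of `s[0], …, s[i]`, and the decoder estimates `s[i]` from
the channel outputs `y[0], …, y[i+T]`, where `none` stands for an erased output. -/
structure StreamingCode (S X : Type*) (T : ℕ) where
  enc : (i : ℕ) → (Fin (i + 1) → S) → X
  dec : (i : ℕ) → (Fin (i + T + 1) → Option X) → S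

namespace StreamingCode

variable {S X : Type*} {T : ℕ}

/-- The channel packet `x[i]` produced by the source stream `s`. -/
def input (c : StreamingCode S X T) (s : ℕ → S) (i : ℕ) : X :=
  c.enc i (fun j => s j)

open Classical in
/-- The channel output `y[i]` for the source stream `s` and the erasure pattern `E`. -/
noncomputable def output (c : StreamingCode S X T) (E : Set ℕ) (s : ℕ → S) (i : ℕ) : Option X :=
  if i ∈ E then none else some (c.input s i)

/-- Under the erasure pattern `E`, the source packet with index `i` is recovered with delay `T`,
whatever the source stream is. -/
def Recovers (c : StreamingCode S X T) (E : Set ℕ) (i : ℕ) : Prop :=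
  ∀ s : ℕ → S, c.dec i (fun j => c.output E s j) = s i

end StreamingCode

/-- In the erasure pattern `E`, the instants `a, …, a + b - 1` are an erasure burst of length
`b ≤ B`, and `t` is an erasure outside the burst which is associated with it: `t` is one of the `T`
instants before or the `T` instants after the burst. The last clause says that the burst is not
a proper part of a longer burst of length at most `B`, so that a run of at most `B` erasures is not
read as a shorter burst with an isolated erasure next to it. -/
def BurstWithIsolated (B T : ℕ) (E : Set ℕ) (a b t : ℕ) : Prop :=
  1 ≤ b ∧ b ≤ B ∧ Set.Ico a (a + b) ⊆ E ∧ t ∈ E ∧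
    ((t < a ∧ a ≤ t + T) ∨ (a + b ≤ t ∧ t < a + b + T)) ∧
    (b = B ∨ (a + b ∉ E ∧ ∀ j, j + 1 = a → j ∉ E))

/-- A partial recovery code for `C_II(B, 2T + B)`: for every erasure pattern of the channel, in
each erasure burst together with its associated isolated erasure all source packets but at most
one are recovered with delay `T`, and every source packet that belongs to no such pair (in
particular every packet of a burst without associated erasure) is recovered with delay `T`. -/
def IsPartialRecoveryCode {S X : Type*} {T : ℕ} (B : ℕ) (c : StreamingCode S X T) : Prop :=
  ∀ E : Set ℕ, ChannelII B (2 * T + B) E →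
    (∀ a b t : ℕ, BurstWithIsolated B T E a b t →
      {i ∈ Set.Ico a (a + b) ∪ {t} | ¬ c.Recovers E i}.Subsingleton) ∧
    (∀ i : ℕ, (∀ a b t : ℕ, BurstWithIsolated B T E a b t → i ∉ Set.Ico a (a + b) ∪ {t}) →
      c.Recovers E i)

/-- The rate `(Δ(T-Δ) + (B+1)) / (Δ(T-Δ) + (B+1)(T-Δ+2))` that belongs to the shift `Δ`. -/
def shiftRate (B T Δ : ℕ) : ℚ :=
  ((Δ : ℚ) * ((T : ℚ) - Δ) + ((B : ℚ) + 1)) /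
    ((Δ : ℚ) * ((T : ℚ) - Δ) + ((B : ℚ) + 1) * ((T : ℚ) - Δ + 2))

/-! Split a source packet into layers u (μ symbols) and v (κ symbols) and send (u[i], v[i], u[i-Δ] +
p₁[i], p₂[i]), where p₁ (μ symbols) and p₂ (σ symbols) are generic causal parities of v. Repetition
protects u; parities protect v, and p₁ is readable only where u[i-Δ] is known. By linearity,
decoding means showing that a stream whose received packets vanish is itself zero in time.

Time is cut into stretches, each starting at 0 or right after a received packet
(`exists_decoded_stretch`). An erasure with none in the next T-Δ+1 instants is repaired by p₂ alone;
otherwise at most B+1 of Δ packets are unusable and the others supply all parities. If the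
repetition of an earlier erased packet falls into such a window, that packet is the isolated erasure
before a burst, and its u is given up. Losses are thus confined to `LossCondition`, which holds for
at most one erasure per pair (`ChannelII.lossCondition_unique`).

Genericity (`exists_isWindowGeneric`) turns decodability into counting. The two counts, taken with
equality, give the rate; where they would force μ < 0, parities alone suffice (`parity_recovery`).
-/

/-! ### Generic matrices under masking. -/

open Finset in
/-- Over a suitable prime field there is a matrix all of whose square submatrices, with any set of
off-diagonal entries replaced by zeros, are nonsingular. -/
theorem exists_masked_superregular (R C : Type) [Fintype R] [Fintype C] :
    ∃ (p : ℕ) (_ : Fact p.Prime) (M : R → C → ZMod p),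
      ∀ (n : ℕ) (f : Fin n → C) (g : Fin n → R) (Z : Fin n → Fin n → Bool),
        f.Injective → g.Injective → (∀ x, Z x x = true) →
        (Matrix.of fun x y => if Z x y then M (g x) (f y) else 0).det ≠ 0 := by
  classical
  let Cfg := Σ n : Fin (Fintype.card C + 1), (Fin n → C) × (Fin n → R) × (Fin n → Fin n → Bool)
  let mat : ∀ {A : Type} [CommRing A] (m : R × C → A) (c : Cfg), Matrix (Fin c.1) (Fin c.1) A :=
    fun m c => Matrix.of fun x y => if c.2.2.2 x y then m (c.2.2.1 x, c.2.1 y) else 0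
  have hmap : ∀ {A A' : Type} [CommRing A] [CommRing A'] (h : A →+* A') (m : R × C → A) (c : Cfg),
      h (mat m c).det = (mat (fun rc => h (m rc)) c).det := by
    intro A A' _ _ h m c
    rw [RingHom.map_det]
    congr 1
    ext x y
    simp only [mat, RingHom.mapMatrix_apply, Matrix.map_apply, Matrix.of_apply]
    split_ifs <;> simp
  let Good : Finset Cfg := univ.filter fun c =>
    c.2.1.Injective ∧ c.2.2.1.Injective ∧ ∀ x, c.2.2.2 x x = true
  let Q : MvPolynomial (R × C) ℤ := ∏ c ∈ Good, (mat MvPolynomial.X c).det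
  have hQ : Q ≠ 0 := by
    refine prod_ne_zero_iff.2 fun c hc h0 => ?_
    obtain ⟨hf, hg, hZ⟩ := (mem_filter.1 hc).2
    -- Setting the matched entries to 1 and all others to 0 makes the masked submatrix the identity,
    -- so its determinant is a nonzero polynomial.
    let pt : R × C → ℤ := fun rc => if ∃ x, c.2.2.1 x = rc.1 ∧ c.2.1 x = rc.2 then 1 else 0
    have h1 := hmap (MvPolynomial.eval pt) MvPolynomial.X c
    have h2 : mat (fun rc => MvPolynomial.eval pt (MvPolynomial.X rc)) c = 1 := by
      ext x y
      simp only [mat, Matrix.of_apply, MvPolynomial.eval_X, Matrix.one_apply, pt]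
      by_cases hxy : x = y
      · subst hxy
        rw [if_pos (hZ x), if_pos ⟨x, rfl, rfl⟩, if_pos rfl]
      · have : ¬ ∃ z, c.2.2.1 z = c.2.2.1 x ∧ c.2.1 z = c.2.1 y := by
          rintro ⟨z, h, h'⟩
          exact hxy ((hg h).symm.trans (hf h'))
        rw [if_neg this, if_neg hxy, ite_self]
    rw [h0, h2, Matrix.det_one, map_zero] at h1
    exact zero_ne_one h1
  obtain ⟨pt, hpt⟩ : ∃ pt, MvPolynomial.eval pt Q ≠ 0 := by
    by_contra! h
    exact hQ (MvPolynomial.funext fun x => by rw [h x, map_zero])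
  -- A prime exceeding the absolute value of the product divides none of the determinants.
  obtain ⟨p, hp, hprime⟩ := Nat.exists_infinite_primes ((MvPolynomial.eval pt Q).natAbs + 1)
  have : Fact p.Prime := ⟨hprime⟩
  refine ⟨p, ⟨hprime⟩, fun r c => (pt (r, c) : ZMod p), fun n f g Z hf hg hZ h0 => ?_⟩
  have hn : n < Fintype.card C + 1 := by
    have := Fintype.card_le_of_injective f hf
    rw [Fintype.card_fin] at this
    omega
  let c : Cfg := ⟨⟨n, hn⟩, f, g, Z⟩
  have hc : c ∈ Good := mem_filter.2 ⟨mem_univ _, hf, hg, hZ⟩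
  have hz : ((MvPolynomial.eval pt Q : ℤ) : ZMod p) = 0 := by
    rw [map_prod, Int.cast_prod]
    refine prod_eq_zero hc ?_
    have h1 := hmap ((Int.castRingHom (ZMod p)).comp (MvPolynomial.eval pt)) MvPolynomial.X c
    simp only [RingHom.comp_apply, MvPolynomial.eval_X, eq_intCast] at h1
    rw [h1]
    exact h0
  rw [ZMod.intCast_zmod_eq_zero_iff_dvd] at hz
  have := Int.natAbs_dvd_natAbs.2 hz
  have := Nat.le_of_dvd (Int.natAbs_pos.2 hpt) this
  rw [Int.natAbs_natCast] at this
  omega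

/-! ### Generic causal parities and window decoding. -/

/-- The parity symbol with index `a` at time `i` of a causal linear code with coefficients `H`. -/
def causalParity {F : Type} [Field F] {κ ρ : ℕ} (H : ℕ → Fin ρ → ℕ → Fin κ → F)
    (v : ℕ → Fin κ → F) (i : ℕ) (a : Fin ρ) : F :=
  ∑ j ∈ Finset.range (i + 1), ∑ c, H i a j c * v j c

theorem causalParity_sub {F : Type} [Field F] {κ ρ : ℕ} (H : ℕ → Fin ρ → ℕ → Fin κ → F)
    (v w : ℕ → Fin κ → F) (i : ℕ) (a : Fin ρ) :
    causalParity H (v - w) i a = causalParity H v i a - causalParity H w i a := by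
  simp only [causalParity, Pi.sub_apply, mul_sub, Finset.sum_sub_distrib]

theorem causalParity_eq_zero {F : Type} [Field F] {κ ρ : ℕ} (H : ℕ → Fin ρ → ℕ → Fin κ → F)
    (v : ℕ → Fin κ → F) (i : ℕ) (a : Fin ρ) (h : ∀ j ≤ i, v j = 0) :
    causalParity H v i a = 0 := by
  refine Finset.sum_eq_zero fun j hj => Finset.sum_eq_zero fun c _ => ?_
  rw [h j (Nat.lt_succ_iff.1 (Finset.mem_range.1 hj)), Pi.zero_apply, mul_zero]

open Finset in
/-- In every window of at most `P` instants, the erased packets at the instants of `D` are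
determined by the parity symbols in `A` as soon as every final segment of the window contains at
least as many symbols of `A` as unknown symbols. -/
def IsWindowGeneric {F : Type} [Field F] {κ ρ : ℕ} (P : ℕ)
    (H : ℕ → Fin ρ → ℕ → Fin κ → F) : Prop :=
  ∀ (j τ : ℕ) (D : Finset ℕ) (A : Finset (ℕ × Fin ρ)) (v : ℕ → Fin κ → F),
    τ < j + P → D ⊆ Icc j τ → (∀ x ∈ A, x.1 ∈ Icc j τ) →
    (∀ m ∈ D, κ * #{d ∈ D | m ≤ d} ≤ #{x ∈ A | m ≤ x.1}) →
    (∀ i ≤ τ, i ∉ D → v i = 0) → (∀ x ∈ A, causalParity H v x.1 x.2 = 0) →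
    ∀ i ≤ τ, v i = 0

theorem mod_injOn_window {P j τ x y : ℕ} (h : τ < j + P) (hx : x ∈ Finset.Icc j τ)
    (hy : y ∈ Finset.Icc j τ) (hxy : x % P = y % P) : x = y := by
  rw [Finset.mem_Icc] at hx hy
  rcases le_total x y with hle | hle
  · have hd := (Nat.modEq_iff_dvd' hle).1 hxy
    have := Nat.eq_zero_of_dvd_of_lt hd (by omega)
    omega
  · have hd := (Nat.modEq_iff_dvd' hle).1 hxy.symm
    have := Nat.eq_zero_of_dvd_of_lt hd (by omega)
    omega

-- Coefficients depend on times modulo P only, so one finite matrix serves all windows. Causality is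
-- the mask, and Hall's theorem turns the count on final segments into a nonzero diagonal.
open Finset in
theorem exists_isWindowGeneric (κ ρ P : ℕ) (hP : 0 < P) :
    ∃ (p : ℕ) (_ : Fact p.Prime) (H : ℕ → Fin ρ → ℕ → Fin κ → ZMod p), IsWindowGeneric P H := by
  classical
  obtain ⟨p, hp, M, hM⟩ := exists_masked_superregular (Fin P × Fin ρ) (Fin P × Fin κ)
  let res : ℕ → Fin P := fun i => ⟨i % P, Nat.mod_lt _ hP⟩
  refine ⟨p, hp, fun i a j c => M (res i, a) (res j, c), ?_⟩
  intro j τ D A v hτ hD hA hall hv hpar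
  let U : Finset (ℕ × Fin κ) := D ×ˢ univ
  have hU : ∀ x : U, x.1.1 ∈ D := fun x => (mem_product.1 x.2).1
  -- A set of unknowns with earliest time m can use every symbol of A from m on, so Hall's condition
  -- only has to be checked on final segments.
  obtain ⟨φ, hφinj, hφ⟩ : ∃ φ : U → ℕ × Fin ρ, φ.Injective ∧
      ∀ x : U, φ x ∈ {y ∈ A | x.1.1 ≤ y.1} := by
    refine (all_card_le_biUnion_card_iff_exists_injective _).1 fun s => ?_
    rcases s.eq_empty_or_nonempty with hs | hs
    · simp [hs]
    obtain ⟨x, hxs, hx⟩ := s.exists_min_image (fun x => x.1.1) hs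
    calc #s = #(s.map (Function.Embedding.subtype _)) := (card_map _).symm
      _ ≤ #({d ∈ D | x.1.1 ≤ d} ×ˢ (univ : Finset (Fin κ))) := by
          refine card_le_card fun y hy => ?_
          obtain ⟨z, hz, rfl⟩ := mem_map.1 hy
          exact mem_product.2 ⟨mem_filter.2 ⟨hU z, hx z hz⟩, mem_univ _⟩
      _ = κ * #{d ∈ D | x.1.1 ≤ d} := by rw [card_product, card_fin, mul_comm]
      _ ≤ #{y ∈ A | x.1.1 ≤ y.1} := hall _ (hU x)
      _ ≤ _ := card_le_card fun y hy => mem_biUnion.2 ⟨x, hxs, hy⟩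
  have hφA : ∀ x, φ x ∈ A := fun x => (mem_filter.1 (hφ x)).1
  let e : Fin (Fintype.card U) ≃ U := (Fintype.equivFin U).symm
  have hdet := hM (Fintype.card U) (fun x => (res (e x).1.1, (e x).1.2))
    (fun x => (res (φ (e x)).1, (φ (e x)).2)) (fun x y => decide ((e y).1.1 ≤ (φ (e x)).1))
    (by
      intro x y hxy
      simp only [res, Prod.mk.injEq, Fin.mk.injEq] at hxy
      refine e.injective (Subtype.ext (Prod.ext ?_ hxy.2))
      exact mod_injOn_window hτ (hD (hU _)) (hD (hU _)) hxy.1)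
    (by
      intro x y hxy
      simp only [res, Prod.mk.injEq, Fin.mk.injEq] at hxy
      refine e.injective (hφinj (Prod.ext ?_ hxy.2))
      exact mod_injOn_window hτ (hA _ (hφA _)) (hA _ (hφA _)) hxy.1)
    (fun x => decide_eq_true (mem_filter.1 (hφ (e x))).2)
  have hw := Matrix.eq_zero_of_mulVec_eq_zero hdet
    (v := fun y => v (e y).1.1 (e y).1.2) (by
      funext x
      have h0 := hpar _ (hφA (e x))
      set r := φ (e x) with hr
      simp only [Matrix.mulVec, dotProduct, Matrix.of_apply, Pi.zero_apply, decide_eq_true_eq]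
      refine Eq.trans ?_ h0
      rw [causalParity, ← hr]
      rw [Equiv.sum_comp e (fun y : U =>
        (if y.1.1 ≤ r.1 then M (res r.1, r.2) (res y.1.1, y.1.2) else 0) * v y.1.1 y.1.2)]
      rw [sum_coe_sort U (fun y : ℕ × Fin κ =>
        (if y.1 ≤ r.1 then M (res r.1, r.2) (res y.1, y.2) else 0) * v y.1 y.2), sum_product]
      have hrτ := (mem_Icc.1 (hA _ (hφA (e x)))).2
      rw [← hr] at hrτ
      have h1 : ∀ d ∈ D, d ∉ {d ∈ D | d ≤ r.1} → ∑ c, (if d ≤ r.1 then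
          M (res r.1, r.2) (res d, c) else 0) * v d c = 0 := by
        intro d hd hd'
        have : ¬ d ≤ r.1 := fun h => hd' (mem_filter.2 ⟨hd, h⟩)
        simp [this]
      rw [← sum_subset (filter_subset _ _) h1]
      have h2 : {d ∈ D | d ≤ r.1} ⊆ range (r.1 + 1) := by
        intro d hd
        exact mem_range.2 (Nat.lt_succ_of_le (mem_filter.1 hd).2)
      rw [← sum_subset h2]
      · refine sum_congr rfl fun d hd => sum_congr rfl fun c _ => ?_
        rw [if_pos (mem_filter.1 hd).2]
      · intro d hd hd'
        have hle := Nat.lt_succ_iff.1 (mem_range.1 hd)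
        have hdD : d ∉ D := fun h => hd' (mem_filter.2 ⟨h, hle⟩)
        rw [hv d (hle.trans hrτ) hdD]
        simp)
  intro i hi
  by_cases hiD : i ∈ D
  · funext c
    have hm : (i, c) ∈ U := mem_product.2 ⟨hiD, mem_univ _⟩
    have := congrFun hw (e.symm ⟨(i, c), hm⟩)
    simpa using this
  · exact hv i hi hiD

open Finset in
/-- If a window of length `L` has enough received symbols, then at some instant `τ` of it every
segment of the window that ends in `τ` has enough of them. -/
theorem exists_balanced_instant {κ ρ j L : ℕ} (hκ : 0 < κ) (D : Finset ℕ)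
    (hD : κ * #(D ∩ Ico j (j + L)) ≤ ρ * #(Ico j (j + L) \ D)) (hL : 0 < L) :
    ∃ τ, j ≤ τ ∧ τ < j + L ∧ τ ∉ D ∧
      ∀ m, j ≤ m → m ∈ D → κ * #(D ∩ Icc m τ) ≤ ρ * #(Icc m τ \ D) := by
  classical
  -- Stop at the first prefix with enough symbols: every shorter nonempty prefix is deficient, so
  -- each remaining segment has enough.
  have hex : ∃ t, j < t ∧ κ * #(D ∩ Ico j t) ≤ ρ * #(Ico j t \ D) := ⟨j + L, by omega, hD⟩
  obtain ⟨hjt, ht⟩ := Nat.find_spec hex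
  have hle : Nat.find hex ≤ j + L := Nat.find_min' hex ⟨by omega, hD⟩
  have hmin : ∀ m, j < m → m < Nat.find hex → ρ * #(Ico j m \ D) < κ * #(D ∩ Ico j m) := by
    intro m hm hm'
    by_contra! h
    exact Nat.find_min hex hm' ⟨hm, h⟩
  generalize Nat.find hex = t at *
  obtain ⟨τ, rfl⟩ : ∃ τ, t = τ + 1 := ⟨t - 1, by omega⟩
  have hsplit : ∀ m, j ≤ m → m ≤ τ + 1 → #(D ∩ Ico j (τ + 1)) = #(D ∩ Ico j m) + #(D ∩ Icc m τ) ∧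
      #(Ico j (τ + 1) \ D) = #(Ico j m \ D) + #(Icc m τ \ D) := by
    intro m h1 h2
    constructor
    · rw [← card_union_of_disjoint]
      · congr 1; ext x; by_cases hx : x ∈ D <;> simp [hx]; omega
      · rw [disjoint_left]; intro x; simp only [mem_inter, mem_Ico, mem_Icc]; intro hx hx'; omega
    · rw [← card_union_of_disjoint]
      · congr 1; ext x; by_cases hx : x ∈ D <;> simp [hx]; omega
      · rw [disjoint_left]; intro x; simp only [mem_sdiff, mem_Ico, mem_Icc]; intro hx hx'; omega
  have hseg : ∀ m, j ≤ m → m ≤ τ → κ * #(D ∩ Icc m τ) ≤ ρ * #(Icc m τ \ D) := by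
    intro m h1 h2
    obtain ⟨h3, h4⟩ := hsplit m h1 (by omega)
    rw [h3, h4, mul_add, mul_add] at ht
    rcases h1.eq_or_lt with rfl | h1
    · simpa using ht
    · have := hmin m h1 (by omega)
      omega
  refine ⟨τ, by omega, by omega, fun hτ => ?_, fun m h1 h2 => ?_⟩
  · have := hseg τ (by omega) le_rfl
    rw [Icc_self, inter_singleton_of_mem hτ, sdiff_eq_empty_iff_subset.2 (by simpa using hτ)] at this
    simp at this
    omega
  · rcases le_or_gt m τ with h | h
    · exact hseg m h1 h
    · simp [Icc_eq_empty_of_lt h]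

open Finset in
/-- If at most `b` of the `L` packets of a window are erased and all parity symbols of the others
are available, then the window is decoded up to one of its instants that is not erased. -/
theorem IsWindowGeneric.decode_window {F : Type} [Field F] {κ ρ P : ℕ}
    {H : ℕ → Fin ρ → ℕ → Fin κ → F} (hH : IsWindowGeneric P H) {j L b : ℕ} (hκ : 0 < κ)
    (hL : 0 < L) (hLP : L ≤ P) (hcount : κ * b ≤ ρ * (L - b)) (D : Finset ℕ)
    (hDb : #(D ∩ Ico j (j + L)) ≤ b) :
    ∃ τ, j ≤ τ ∧ τ < j + L ∧ τ ∉ D ∧ ∀ v : ℕ → Fin κ → F, (∀ i < j, v i = 0) →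
      (∀ i, j ≤ i → i ≤ τ → i ∉ D → v i = 0 ∧ ∀ a, causalParity H v i a = 0) →
      ∀ i ≤ τ, v i = 0 := by
  have hcard : #(Ico j (j + L) \ D) + #(D ∩ Ico j (j + L)) = L := by
    rw [inter_comm, card_sdiff_add_card_inter, Nat.card_Ico, Nat.add_sub_cancel_left]
  obtain ⟨τ, h1, h2, h3, h4⟩ := exists_balanced_instant (κ := κ) (ρ := ρ) (j := j) (L := L) hκ D
    (calc κ * #(D ∩ Ico j (j + L)) ≤ κ * b := Nat.mul_le_mul_left _ hDb
      _ ≤ ρ * (L - b) := hcount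
      _ ≤ _ := Nat.mul_le_mul_left _ (by omega)) hL
  refine ⟨τ, h1, h2, h3, fun v hv0 hv => ?_⟩
  refine hH j τ (D ∩ Icc j τ) ((Icc j τ \ D) ×ˢ univ) v (by omega) inter_subset_right
    (fun x hx => (mem_sdiff.1 (mem_product.1 hx).1).1) (fun m hm => ?_) (fun i hi hiD => ?_)
    (fun x hx => ?_)
  · obtain ⟨hmD, hm⟩ := mem_inter.1 hm
    have hjm := (mem_Icc.1 hm).1
    have e1 : {d ∈ D ∩ Icc j τ | m ≤ d} = D ∩ Icc m τ := by
      ext x; by_cases hx : x ∈ D <;> simp [hx]; omega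
    have e2 : {x ∈ (Icc j τ \ D) ×ˢ (univ : Finset (Fin ρ)) | m ≤ x.1} =
        (Icc m τ \ D) ×ˢ univ := by
      ext ⟨x, a⟩; by_cases hx : x ∈ D <;> simp [hx]; omega
    rw [e1, e2, card_product, card_fin, mul_comm _ ρ]
    exact h4 m hjm hmD
  · rcases lt_or_ge i j with h | h
    · exact hv0 i h
    · exact (hv i h hi fun hD => hiD (mem_inter.2 ⟨hD, mem_Icc.2 ⟨h, hi⟩⟩)).1
  · have hx := mem_sdiff.1 (mem_product.1 hx).1
    have := mem_Icc.1 hx.1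
    exact (hv _ this.1 this.2 hx.2).2 _

open Finset in
/-- A single erased packet is recovered from the last `σ` parity symbols of `l` later packets. -/
theorem IsWindowGeneric.decode_single {F : Type} [Field F] {κ ρ σ P : ℕ}
    {H : ℕ → Fin (ρ + σ) → ℕ → Fin κ → F} (hH : IsWindowGeneric P H) {j l : ℕ}
    (hlP : l < P) (hcount : κ ≤ l * σ) (v : ℕ → Fin κ → F) (hv0 : ∀ i < j, v i = 0)
    (hv : ∀ i, j < i → i ≤ j + l → v i = 0 ∧ ∀ a, causalParity H v i (Fin.natAdd ρ a) = 0) :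
    ∀ i ≤ j + l, v i = 0 := by
  classical
  refine hH j (j + l) {j} (Ioc j (j + l) ×ˢ univ.map (Fin.natAddEmb ρ)) v (by omega) (by simp)
    (fun x hx => ?_) (fun m hm => ?_) (fun i hi hij => ?_) (fun x hx => ?_)
  · have := mem_Ioc.1 (mem_product.1 hx).1
    exact mem_Icc.2 ⟨this.1.le, this.2⟩
  · rw [mem_singleton] at hm
    subst hm
    have e : {x ∈ Ioc m (m + l) ×ˢ (univ : Finset (Fin σ)).map (Fin.natAddEmb ρ) | m ≤ x.1} =
        Ioc m (m + l) ×ˢ univ.map (Fin.natAddEmb ρ) := by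
      refine filter_true_of_mem fun x hx => ?_
      exact (mem_Ioc.1 (mem_product.1 hx).1).1.le
    rw [e, card_product, card_map, card_fin, Nat.card_Ioc, Nat.add_sub_cancel_left]
    simpa [filter_singleton] using hcount
  · rw [mem_singleton] at hij
    rcases lt_or_gt_of_ne hij with h | h
    · exact hv0 i h
    · exact (hv i h hi).1
  · obtain ⟨h1, h2⟩ := mem_product.1 hx
    obtain ⟨a, -, ha⟩ := mem_map.1 h2
    have := mem_Ioc.1 h1
    rw [← ha]
    exact (hv _ this.1 this.2).2 a

/-! ### Erasure patterns of the channel and possible losses. -/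

/-- The channel leaves at most `B + 1` erasures in each window of length at most `W`. -/
theorem ChannelII.card_le {B W : ℕ} {E : Set ℕ} (hE : ChannelII B W E) {j L : ℕ} (hL : L ≤ W)
    (D : Finset ℕ) (hD : ∀ x ∈ D, x ∈ E ∧ x ∈ Set.Ico j (j + L)) : D.card ≤ B + 1 := by
  classical
  obtain ⟨a, b, I, hb, hI, h⟩ := hE j
  have hsub : ∀ x ∈ D, x ∈ Set.Ico a (a + b) ∪ I := by
    intro x hx
    rw [← h]
    obtain ⟨h1, h2, h3⟩ := hD x hx
    exact ⟨h1, h2, by omega⟩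
  have h1 : (D.filter (· ∈ I)).card ≤ 1 := Finset.card_le_one.2 fun x hx y hy =>
    hI (Finset.mem_filter.1 hx).2 (Finset.mem_filter.1 hy).2
  have h2 : (D.filter (· ∉ I)).card ≤ b := by
    refine (Finset.card_le_card (t := Finset.Ico a (a + b)) fun x hx => ?_).trans (by simp)
    obtain ⟨hx, hxI⟩ := Finset.mem_filter.1 hx
    exact Finset.mem_Ico.2 ((hsub x hx).resolve_right hxI)
  have := Finset.card_filter_add_card_filter_not (s := D) (· ∈ I)
  omega

/-- Sufficient condition for the loss of a source packet with index `i` in the layered code with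
shift `Δ`: the packet that repeats it is erased, or a burst of length at least two begins in
between. -/
def LossCondition (Δ : ℕ) (E : Set ℕ) (i : ℕ) : Prop :=
  i + Δ ∈ E ∨ ∃ j, i < j ∧ j + 1 ≤ i + Δ ∧ j ∉ E ∧ j + 1 ∈ E ∧ j + 2 ∈ E

/-- In a window of the channel at most one packet satisfies the loss condition. -/
theorem ChannelII.lossCondition_unique {B W Δ : ℕ} {E : Set ℕ} (hE : ChannelII B W E)
    (hΔ : B < Δ) {w x y : ℕ} (hx : w ≤ x) (hy : w ≤ y) (hxw : x + Δ + 1 < w + W)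
    (hyw : y + Δ + 1 < w + W) (hxE : x ∈ E) (hyE : y ∈ E)
    (hlx : LossCondition Δ E x) (hly : LossCondition Δ E y) : x = y := by
  obtain ⟨a, b, I, hb, hI, h⟩ := hE w
  have hin : ∀ z, w ≤ z → z < w + W → z ∈ E → (a ≤ z ∧ z < a + b) ∨ z ∈ I := fun z h1 h2 h3 => by
    have : z ∈ E ∩ Set.Ico w (w + W) := ⟨h3, h1, h2⟩
    rwa [h] at this
  have hrun : ∀ z, a ≤ z → z < a + b → z ∈ E := fun z h1 h2 => by
    have : z ∈ Set.Ico a (a + b) ∪ I := Or.inl ⟨h1, h2⟩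
    rw [← h] at this
    exact this.1
  -- a packet that is lost because of a later burst is the isolated erasure
  have key : ∀ z j, w ≤ z → z + Δ + 1 < w + W → z ∈ E → z < j → j + 1 ≤ z + Δ → j ∉ E →
      j + 1 ∈ E → j + 2 ∈ E → z ∈ I ∧ a = j + 1 ∧ a + 1 < a + b := by
    intro z j h1 h2 h3 h4 h5 h6 h7 h8
    have haj : ¬ (a ≤ j ∧ j < a + b) := fun h' => h6 (hrun j h'.1 h'.2)
    rcases hin z h1 (by omega) h3 with hz | hz
    · rcases hin _ (by omega) (by omega) h7 with h9 | h9
      · omega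
      · rcases hin _ (by omega) (by omega) h8 with h10 | h10
        · omega
        · have := hI h9 h10
          omega
    · refine ⟨hz, ?_⟩
      rcases hin _ (by omega) (by omega) h7 with h9 | h9
      · rcases hin _ (by omega) (by omega) h8 with h10 | h10
        · omega
        · have := hI hz h10
          omega
      · have := hI hz h9
        omega
  have key1 : ∀ z, w ≤ z → z + Δ + 1 < w + W → z ∈ E → z + Δ ∈ E → z ∈ I ∨ z + Δ ∈ I := by
    intro z h1 h2 h3 h4
    rcases hin z h1 (by omega) h3 with hz | hz
    · rcases hin _ (by omega) (by omega) h4 with h5 | h5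
      · omega
      · exact Or.inr h5
    · exact Or.inl hz
  -- The hypotheses are contradictory: z = z' + Δ would be the isolated erasure, leaving z' and z +
  -- Δ in one burst at distance 2Δ > B.
  have key2 : ∀ z z', w ≤ z → z + Δ + 1 < w + W → z ∈ E → z + Δ ∈ E → w ≤ z' →
      z' + Δ + 1 < w + W → z' ∈ E → z' + Δ ∈ E → z ∈ I → z' + Δ ∈ I → z = z' := by
    intro z z' h1 h2 h3 h4 h5 h6 h7 h8 h9 h10
    have he := hI h9 h10
    rcases hin (z + Δ) (by omega) (by omega) h4 with h11 | h11
    · rcases hin z' (by omega) (by omega) h7 with h12 | h12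
      · omega
      · have := hI h12 h10
        omega
    · have := hI h9 h11
      omega
  have key3 : ∀ z z' j, w ≤ z → z + Δ + 1 < w + W → z ∈ E → z + Δ ∈ E → w ≤ z' →
      z' + Δ + 1 < w + W → z' ∈ E → z' < j → j + 1 ≤ z' + Δ → j ∉ E → j + 1 ∈ E → j + 2 ∈ E →
      z = z' := by
    intro z z' j h1 h2 h3 h4 h5 h6 h7 h8 h9 h10 h11 h12
    obtain ⟨h13, h14, h15⟩ := key z' j h5 h6 h7 h8 h9 h10 h11 h12
    rcases key1 z h1 h2 h3 h4 with h | h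
    · exact hI h h13
    · have := hI h h13
      rcases hin z h1 (by omega) h3 with h16 | h16
      · omega
      · exact hI h16 h13
  rcases hlx with hlx | ⟨j, h1, h2, h3, h4, h5⟩
  · rcases hly with hly | ⟨j, h1, h2, h3, h4, h5⟩
    · rcases key1 x hx hxw hxE hlx with h6 | h6 <;> rcases key1 y hy hyw hyE hly with h7 | h7
      · exact hI h6 h7
      · exact key2 x y hx hxw hxE hlx hy hyw hyE hly h6 h7
      · exact (key2 y x hy hyw hyE hly hx hxw hxE hlx h7 h6).symm
      · have := hI h6 h7
        omega
    · exact key3 x y j hx hxw hxE hlx hy hyw hyE h1 h2 h3 h4 h5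
  · rcases hly with hly | ⟨j', h1', h2', h3', h4', h5'⟩
    · exact (key3 y x j hy hyw hyE hly hx hxw hxE h1 h2 h3 h4 h5).symm
    · exact hI (key x j hx hxw hxE h1 h2 h3 h4 h5).1 (key y j' hy hyw hyE h1' h2' h3' h4' h5').1

/-- Every erasure lies in a run of erasures that is a burst as in `BurstWithIsolated`. -/
theorem exists_burst_of_mem {B : ℕ} (hB : 1 ≤ B) {E : Set ℕ} {i : ℕ} (hi : i ∈ E) :
    ∃ a b, 1 ≤ b ∧ b ≤ B ∧ Set.Ico a (a + b) ⊆ E ∧ a ≤ i ∧ i < a + b ∧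
      (b = B ∨ (a + b ∉ E ∧ ∀ j, j + 1 = a → j ∉ E)) := by
  classical
  -- Take the leftmost start within reach of i, then the greatest length up to B; if that length is
  -- below B, the run cannot be extended on either side.
  have hex : ∃ a, a ≤ i ∧ i < a + B ∧ ∀ z, a ≤ z → z ≤ i → z ∈ E :=
    ⟨i, le_rfl, by omega, fun z h1 h2 => by rwa [le_antisymm h2 h1]⟩
  obtain ⟨h1, h2, h3⟩ := Nat.find_spec hex
  have hmin : ∀ m < Nat.find hex, ¬ (m ≤ i ∧ i < m + B ∧ ∀ z, m ≤ z → z ≤ i → z ∈ E) :=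
    fun m hm => Nat.find_min hex hm
  generalize Nat.find hex = a at *
  let p : ℕ → Prop := fun b => i < a + b ∧ ∀ z, a ≤ z → z < a + b → z ∈ E
  have hp0 : p (i + 1 - a) := ⟨by omega, fun z h4 h5 => h3 z h4 (by omega)⟩
  have hle : i + 1 - a ≤ B := by omega
  obtain ⟨h4, h5⟩ : p (Nat.findGreatest p B) := Nat.findGreatest_spec hle hp0
  have hb : Nat.findGreatest p B ≤ B := Nat.findGreatest_le B
  have hmax : ∀ b, Nat.findGreatest p B < b → b ≤ B → ¬ p b :=
    fun b h h' => Nat.findGreatest_is_greatest h h'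
  generalize Nat.findGreatest p B = b at *
  refine ⟨a, b, by omega, hb, fun z hz => h5 z hz.1 hz.2, h1, h4, ?_⟩
  rcases hb.eq_or_lt with hbB | hbB
  · exact Or.inl hbB
  · refine Or.inr ⟨fun hE => ?_, fun j hj hE => ?_⟩
    · refine hmax (b + 1) (by omega) hbB ⟨by omega, fun z h6 h7 => ?_⟩
      rcases (show z < a + b ∨ z = a + b by omega) with h | rfl
      · exact h5 z h6 h
      · exact hE
    · refine hmin j (by omega) ⟨by omega, by omega, fun z h6 h7 => ?_⟩
      rcases h6.eq_or_lt with rfl | h6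
      · exact hE
      · exact h3 z (by omega) h7

/-- A code that recovers with delay `T` all packets but those that satisfy the loss condition is a
partial recovery code. -/
theorem isPartialRecoveryCode_of_lossCondition {S X : Type*} {B T Δ : ℕ} (hΔ : B < Δ) (hT : Δ < T)
    (c : StreamingCode S X T)
    (hc : ∀ E, ChannelII B (2 * T + B) E → ∀ i, (i ∈ E → ¬ LossCondition Δ E i) →
      c.Recovers E i) : IsPartialRecoveryCode B c := by
  intro E hE
  have hloss : ∀ i, ¬ c.Recovers E i → i ∈ E ∧ LossCondition Δ E i := by
    intro i hi
    by_contra h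
    exact hi (hc E hE i fun h1 h2 => h ⟨h1, h2⟩)
  constructor
  · rintro a b t ⟨hb1, hbB, hsub, htE, hta, -⟩ x ⟨hx, hxR⟩ y ⟨hy, hyR⟩
    obtain ⟨hxE, hlx⟩ := hloss x hxR
    obtain ⟨hyE, hly⟩ := hloss y hyR
    simp only [Set.mem_union, Set.mem_Ico, Set.mem_singleton_iff] at hx hy
    rcases hta with hta | hta
    -- The pair spans at most T + B instants and Δ < T, so a window of length 2T + B also contains
    -- the later erasures that cause a loss.
    · exact hE.lossCondition_unique hΔ (w := t) (by omega) (by omega) (by omega) (by omega)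
        hxE hyE hlx hly
    · exact hE.lossCondition_unique hΔ (w := a) (by omega) (by omega) (by omega) (by omega)
        hxE hyE hlx hly
  · intro i hi
    by_contra hR
    obtain ⟨hiE, hl⟩ := hloss i hR
    obtain ⟨t, htE, hit, htΔ, hgap⟩ : ∃ t ∈ E, i < t ∧ t ≤ i + Δ ∧
        (t = i + Δ ∨ ∃ j, i < j ∧ j < t ∧ j ∉ E) := by
      rcases hl with hl | ⟨j, h1, h2, h3, h4, h5⟩
      · exact ⟨i + Δ, hl, by omega, le_rfl, Or.inl rfl⟩
      · exact ⟨j + 1, h4, by omega, h2, Or.inr ⟨j, h1, by omega, h3⟩⟩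
    -- For B = 0 there are no bursts and hence no pairs; two erasures this close already violate the
    -- channel.
    rcases Nat.eq_zero_or_pos B with hB | hB
    · obtain ⟨a, b, I, hb, hI, h⟩ := hE i
      have hb0 : b = 0 := by omega
      subst hb0
      rw [add_zero, Set.Ico_self, Set.empty_union] at h
      have h1 : i ∈ I := by rw [← h]; exact ⟨hiE, le_rfl, by omega⟩
      have h2 : t ∈ I := by rw [← h]; exact ⟨htE, by omega, by omega⟩
      have := hI h1 h2
      omega
    · obtain ⟨a, b, hb1, hbB, hsub, hai, hib, hmax⟩ := exists_burst_of_mem hB hiE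
      refine hi a b t ⟨hb1, hbB, hsub, htE, Or.inr ⟨?_, by omega⟩, hmax⟩ (Or.inl ⟨hai, hib⟩)
      rcases hgap with rfl | ⟨j, h1, h2, h3⟩
      · omega
      · have : ¬ j < a + b := fun h => h3 (hsub ⟨by omega, h⟩)
        omega

/-! ### Decoding the layered code. -/

/-- The packets `(u[i], v[i], u[i-Δ] + p₁[i], p₂[i])` of the layered code vanish at the instants
`i ≤ N` that are not in `E`; here `(p₁, p₂)` are the parity symbols of `v`. -/
def LayeredSilent {F : Type} [Field F] {κ μ σ : ℕ} (H : ℕ → Fin (μ + σ) → ℕ → Fin κ → F) (Δ : ℕ)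
    (E : Set ℕ) (u : ℕ → Fin μ → F) (v : ℕ → Fin κ → F) (N : ℕ) : Prop :=
  ∀ i ≤ N, i ∉ E → u i = 0 ∧ v i = 0 ∧
    (∀ a, (if Δ ≤ i then u (i - Δ) a else 0) + causalParity H v i (Fin.castAdd σ a) = 0) ∧
    ∀ a, causalParity H v i (Fin.natAdd μ a) = 0

section Layered

variable {F : Type} [Field F] {κ μ σ : ℕ} {H : ℕ → Fin (μ + σ) → ℕ → Fin κ → F} {Δ : ℕ}
  {E : Set ℕ} {u : ℕ → Fin μ → F} {v : ℕ → Fin κ → F} {N : ℕ}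

theorem LayeredSilent.mono (h : LayeredSilent H Δ E u v N) {N' : ℕ} (hN : N' ≤ N) :
    LayeredSilent H Δ E u v N' :=
  fun i hi => h i (hi.trans hN)

/-- All parity symbols are available where the superimposed packet is not erased. -/
theorem LayeredSilent.parity_eq_zero (h : LayeredSilent H Δ E u v N) {i : ℕ} (hi : i ≤ N)
    (hiE : i ∉ E) (hclean : Δ ≤ i → i - Δ ∉ E) (a : Fin (μ + σ)) : causalParity H v i a = 0 := by
  obtain ⟨-, -, h1, h2⟩ := h i hi hiE
  refine Fin.addCases (fun a => ?_) (fun a => h2 a) a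
  have h3 := h1 a
  split_ifs at h3 with hΔ
  · rwa [(h (i - Δ) (by omega) (hclean hΔ)).1, Pi.zero_apply, zero_add] at h3
  · rwa [zero_add] at h3

/-- The repeated packet is recovered once the superimposed parity symbols are known. -/
theorem LayeredSilent.repeated_eq_zero (h : LayeredSilent H Δ E u v N) {i : ℕ} (hi : i + Δ ≤ N)
    (hiE : i + Δ ∉ E) (hv : ∀ j ≤ i + Δ, v j = 0) : u i = 0 := by
  funext a
  have h1 := (h (i + Δ) hi hiE).2.2.1 a
  rwa [if_pos (Nat.le_add_left _ _), Nat.add_sub_cancel,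
    causalParity_eq_zero H v _ _ hv, add_zero] at h1

end Layered

open Finset in
/-- A stretch of the stream that begins after a received packet is decoded up to an instant `τ`
that meets all deadlines, except for packets that satisfy the loss condition. -/
theorem exists_decoded_stretch {F : Type} [Field F] {κ μ σ B T Δ : ℕ}
    {H : ℕ → Fin (μ + σ) → ℕ → Fin κ → F} (hH : IsWindowGeneric (T + 1) H)
    (hκ : 0 < κ) (hBΔ : B < Δ) (hΔT : Δ < T)
    (hcount : κ * (B + 1) ≤ (μ + σ) * (Δ - (B + 1))) (hcount' : κ ≤ (T - Δ + 1) * σ)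
    {E : Set ℕ} (hE : ChannelII B (2 * T + B) E) {j : ℕ} (hj : ∀ e, e + 1 = j → e ∉ E) :
    ∃ τ, j ≤ τ ∧ τ ∉ E ∧ τ ≤ j + T ∧
      (∀ i ∈ E, i + Δ ∉ E → j ≤ i + Δ → i + Δ ≤ τ → τ ≤ i + T ∨ LossCondition Δ E i) ∧
      ∀ (u : ℕ → Fin μ → F) (v : ℕ → Fin κ → F), LayeredSilent H Δ E u v τ →
        (∀ i < j, v i = 0) → ∀ i ≤ τ, v i = 0 := by
  classical
  by_cases hjE : j ∈ E
  swap
  · refine ⟨j, le_rfl, hjE, by omega, fun i _ _ h1 h2 => Or.inl (by omega), fun u v h hv i hi => ?_⟩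
    rcases hi.eq_or_lt with rfl | hi
    · exact (h i le_rfl hjE).2.1
    · exact hv i hi
  -- Since j is erased, a received repetition in the stretch lies at j + 1 or later; this allows T -
  -- Δ + 1 further instants before its deadline.
  by_cases hsingle : ∀ i, j < i → i ≤ j + (T - Δ + 1) → i ∉ E
  · refine ⟨j + (T - Δ + 1), by omega, hsingle _ (by omega) le_rfl, by omega,
      fun i hi hi' h1 h2 => Or.inl ?_, fun u v h hv => ?_⟩
    · have : i + Δ ≠ j := fun h => hi' (h ▸ hjE)
      omega
    · refine hH.decode_single (by omega) hcount' v hv fun i h1 h2 => ?_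
      have := h i h2 (hsingle i h1 h2)
      exact ⟨this.2.1, this.2.2.2⟩
  push Not at hsingle
  obtain ⟨j', hjj', hj', hj'E⟩ := hsingle
  let D₀ : Finset ℕ := {x ∈ Ico j (j + Δ) | x ∈ E}
  have hD₀ : ∀ x, x ∈ D₀ ↔ (j ≤ x ∧ x < j + Δ) ∧ x ∈ E := fun x => by
    rw [mem_filter, mem_Ico]
  -- If no received packet of the window carries the repetition of an erased one, all its parities
  -- are available.
  by_cases hclean : ∀ i, j ≤ i → i < j + Δ → i ∉ E → Δ ≤ i → i - Δ ∉ E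
  · obtain ⟨τ, h1, h2, h3, h4⟩ := hH.decode_window (j := j) (L := Δ) hκ (by omega) (by omega)
      hcount D₀ (hE.card_le (j := j) (L := Δ) (by omega) _ fun x hx => by
        obtain ⟨hx, -⟩ := mem_inter.1 hx
        exact ⟨((hD₀ x).1 hx).2, ((hD₀ x).1 hx).1⟩)
    have hτE : ∀ i, j ≤ i → i ≤ τ → i ∉ D₀ → i ∉ E := fun i h5 h6 h7 h8 =>
      h7 ((hD₀ i).2 ⟨⟨h5, by omega⟩, h8⟩)
    refine ⟨τ, h1, hτE τ h1 le_rfl h3, by omega, fun i hi hi' h5 h6 => ?_, fun u v h hv => ?_⟩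
    · exact absurd (by rwa [Nat.add_sub_cancel]) (hclean (i + Δ) h5 (by omega) hi' (by omega))
    · refine h4 v hv fun i h5 h6 h7 => ?_
      have h8 := hτE i h5 h6 h7
      exact ⟨(h i h6 h8).2.1, h.parity_eq_zero h6 h8 (hclean i h5 (by omega) h8)⟩
  push Not at hclean
  obtain ⟨i₀, hi₀, hi₀', hi₀E, hΔi₀, heE⟩ := hclean
  obtain ⟨e, rfl⟩ : ∃ e, i₀ = e + Δ := ⟨i₀ - Δ, by omega⟩
  rw [Nat.add_sub_cancel] at heE
  obtain ⟨g, rfl⟩ : ∃ g, j = g + 1 := ⟨j - 1, by omega⟩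
  have hgE : g ∉ E := hj g rfl
  have heg : e ≠ g := fun h => hgE (h ▸ heE)
  obtain ⟨a, b, I, hb, hI, hw⟩ := hE (g + 1 - Δ)
  have hin : ∀ z, g + 1 - Δ ≤ z → z < g + 1 - Δ + (2 * T + B) → z ∈ E →
      (a ≤ z ∧ z < a + b) ∨ z ∈ I := fun z h1 h2 h3 => by
    have : z ∈ E ∩ Set.Ico (g + 1 - Δ) (g + 1 - Δ + (2 * T + B)) := ⟨h3, h1, h2⟩
    rwa [hw] at this
  have hrun : ∀ z, a ≤ z → z < a + b → z ∈ E := fun z h1 h2 => by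
    have : z ∈ Set.Ico a (a + b) ∪ I := Or.inl ⟨h1, h2⟩
    rw [← hw] at this
    exact this.1
  have hag : ¬ (a ≤ g ∧ g < a + b) := fun h => hgE (hrun g h.1 h.2)
  -- A burst through e would end before the received g, leaving both j and j' to be isolated. So e
  -- is isolated and a burst of length at least two starts at j.
  obtain ⟨heI, hja, hjb⟩ : e ∈ I ∧ a = g + 1 ∧ a + 1 < a + b := by
    rcases hin e (by omega) (by omega) heE with he | he
    · exfalso
      rcases hin _ (by omega) (by omega) hjE with h1 | h1
      · omega
      · rcases hin _ (by omega) (by omega) hj'E with h2 | h2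
        · omega
        · have := hI h1 h2
          omega
    · refine ⟨he, ?_⟩
      rcases hin _ (by omega) (by omega) hjE with h1 | h1
      · rcases hin _ (by omega) (by omega) hj'E with h2 | h2
        · omega
        · have := hI he h2
          omega
      · have := hI he h1
        omega
  have hloss : LossCondition Δ E e :=
    Or.inr ⟨g, by omega, by omega, hgE, hjE, hrun _ (by omega) (by omega)⟩
  have heq : ∀ i ∈ E, g + 1 ≤ i + Δ → i + Δ < g + 1 + Δ → i = e := by
    intro i hi h1 h2
    rcases hin i (by omega) (by omega) hi with h3 | h3
    · omega
    · exact hI h3 heI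
  -- The contaminated packet at e + Δ is treated as erased; with e outside the window, the count is
  -- still at most B + 1.
  obtain ⟨τ, h1, h2, h3, h4⟩ := hH.decode_window (j := g + 1) (L := Δ) hκ (by omega) (by omega)
    hcount (insert (e + Δ) D₀) (by
      have hsub : insert (e + Δ) D₀ ∩ Ico (g + 1) (g + 1 + Δ) ⊆ insert (e + Δ) (Ico a (a + b)) := by
        intro x hx
        rcases mem_insert.1 (mem_inter.1 hx).1 with rfl | hx
        · exact mem_insert_self _ _
        · obtain ⟨h5, h6⟩ := (hD₀ x).1 hx
          refine mem_insert_of_mem (mem_Ico.2 ?_)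
          rcases hin x (by omega) (by omega) h6 with h7 | h7
          · exact h7
          · have := hI heI h7
            omega
      refine (card_le_card hsub).trans ((card_insert_le _ _).trans ?_)
      rw [Nat.card_Ico]
      omega)
  have hτE : ∀ i, g + 1 ≤ i → i ≤ τ → i ∉ insert (e + Δ) D₀ → i ∉ E := fun i h5 h6 h7 h8 =>
    h7 (mem_insert_of_mem ((hD₀ i).2 ⟨⟨h5, by omega⟩, h8⟩))
  refine ⟨τ, h1, hτE τ h1 le_rfl h3, by omega, fun i hi hi' h5 h6 => Or.inr ?_, fun u v h hv => ?_⟩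
  · rwa [heq i hi h5 (by omega)]
  · refine h4 v hv fun i h5 h6 h7 => ?_
    have h8 := hτE i h5 h6 h7
    refine ⟨(h i h6 h8).2.1, h.parity_eq_zero h6 h8 fun h9 h10 => ?_⟩
    have := heq (i - Δ) h10 (by omega) (by omega)
    exact h7 (mem_insert.2 (Or.inl (by omega)))

/-- The layered code recovers in time all packets but those satisfying the loss condition. -/
theorem layered_recovery {F : Type} [Field F] {κ μ σ B T Δ : ℕ}
    {H : ℕ → Fin (μ + σ) → ℕ → Fin κ → F} (hH : IsWindowGeneric (T + 1) H)
    (hBΔ : B < Δ) (hΔT : Δ < T)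
    (hcount : κ * (B + 1) ≤ (μ + σ) * (Δ - (B + 1))) (hcount' : κ ≤ (T - Δ + 1) * σ)
    {E : Set ℕ} (hE : ChannelII B (2 * T + B) E) {u : ℕ → Fin μ → F} {v : ℕ → Fin κ → F} {i : ℕ}
    (hi : i ∈ E → ¬ LossCondition Δ E i) (h : LayeredSilent H Δ E u v (i + T)) :
    u i = 0 ∧ v i = 0 := by
  have hstretch : ∀ k, ∃ j τ, j ≤ k ∧ k ≤ τ ∧ (κ = 0 ∨ τ ∉ E) ∧ τ ≤ j + T ∧
      (∀ i ∈ E, i + Δ ∉ E → j ≤ i + Δ → i + Δ ≤ τ → τ ≤ i + T ∨ LossCondition Δ E i) ∧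
      ∀ (u : ℕ → Fin μ → F) (v : ℕ → Fin κ → F), LayeredSilent H Δ E u v τ →
        ∀ i ≤ τ, v i = 0 := by
    -- For Δ = B + 1 the chosen dimensions have κ = 0: pure repetition.
    rcases Nat.eq_zero_or_pos κ with rfl | hκ
    · exact fun k => ⟨k, k, le_rfl, le_rfl, Or.inl rfl, by omega,
        fun i _ _ h1 h2 => Or.inl (by omega), fun u v _ i _ => Subsingleton.elim _ _⟩
    intro k
    induction k with
    | zero =>
      obtain ⟨τ, h1, h2, h3, h4, h5⟩ := exists_decoded_stretch hH hκ hBΔ hΔT hcount hcount' hE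
        (j := 0) (fun e he => by omega)
      exact ⟨0, τ, le_rfl, h1, Or.inr h2, h3, h4, fun u v h => h5 u v h fun i hi => by omega⟩
    | succ k ih =>
      obtain ⟨j, τ, h1, h2, h3, h4, h5, h6⟩ := ih
      rcases h2.eq_or_lt with rfl | h2
      · have h3 := h3.resolve_left hκ.ne'
        obtain ⟨τ, h7, h8, h9, h10, h11⟩ := exists_decoded_stretch hH hκ hBΔ hΔT hcount hcount' hE
          (j := k + 1) (fun e he => by rwa [show e = k by omega])
        exact ⟨k + 1, τ, le_rfl, h7, Or.inr h8, h9, h10, fun u v h => h11 u v h fun i hi =>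
          h6 u v (h.mono (by omega)) i (by omega)⟩
      · exact ⟨j, τ, by omega, h2, h3, h4, h5, h6⟩
  by_cases hiE : i ∈ E
  swap
  · exact ⟨(h i (by omega) hiE).1, (h i (by omega) hiE).2.1⟩
  have hloss := hi hiE
  constructor
  · have hiΔ : i + Δ ∉ E := fun h => hloss (Or.inl h)
    -- For u[i] the relevant stretch is the one containing i + Δ, where the repetition is cleared of
    -- its parity.
    obtain ⟨j, τ, h1, h2, -, -, h5, h6⟩ := hstretch (i + Δ)
    have hτ := (h5 i hiE hiΔ h1 h2).resolve_right hloss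
    exact h.repeated_eq_zero (by omega) hiΔ fun k hk => h6 u v (h.mono hτ) k (by omega)
  · obtain ⟨j, τ, h1, h2, -, h4, -, h6⟩ := hstretch i
    exact h6 u v (h.mono (by omega)) i h2

open Finset in
/-- Without a repeated layer, the code recovers every packet in time. -/
theorem parity_recovery {F : Type} [Field F] {κ σ B T Δ : ℕ}
    {H : ℕ → Fin (0 + σ) → ℕ → Fin κ → F} (hH : IsWindowGeneric (T + 1) H)
    (hcount : κ * (B + 1) ≤ (0 + σ) * (T + 1 - (B + 1)))
    {E : Set ℕ} (hE : ChannelII B (2 * T + B) E) (hT : 0 < T) {u : ℕ → Fin 0 → F}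
    {v : ℕ → Fin κ → F} {i : ℕ} (h : LayeredSilent H Δ E u v (i + T)) :
    u i = 0 ∧ v i = 0 := by
  classical
  refine ⟨Subsingleton.elim _ _, ?_⟩
  rcases Nat.eq_zero_or_pos κ with rfl | hκ
  · exact Subsingleton.elim _ _
  induction i using Nat.strong_induction_on with
  | _ i ih =>
    let D : Finset ℕ := {x ∈ Ico i (i + (T + 1)) | x ∈ E}
    obtain ⟨τ, h1, h2, h3, h4⟩ := hH.decode_window (j := i) (L := T + 1) hκ (by omega) le_rfl
      hcount D (hE.card_le (j := i) (L := T + 1) (by omega) _ fun x hx => by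
        obtain ⟨h1, h2⟩ := mem_filter.1 (mem_inter.1 hx).1
        exact ⟨h2, mem_Ico.1 h1⟩)
    refine h4 v (fun k hk => ih k hk (h.mono (by omega))) (fun k h5 h6 h7 => ?_) i h1
    have hkE : k ∉ E := fun h => h7 (mem_filter.2 ⟨mem_Ico.2 ⟨h5, by omega⟩, h⟩)
    obtain ⟨-, h8, -, h9⟩ := h k (by omega) hkE
    exact ⟨h8, fun a => Fin.addCases (fun a => a.elim0) h9 a⟩

/-! ### Encoder, decoder and the choice of dimensions. -/

/-- Every encoder has a decoder that recovers each packet determined by the received packets. -/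
theorem exists_streamingCode {S X : Type*} [Inhabited S] (T : ℕ)
    (enc : (i : ℕ) → (Fin (i + 1) → S) → X) :
    ∃ c : StreamingCode S X T, ∀ (E : Set ℕ) (i : ℕ),
      (∀ s s' : ℕ → S, (∀ j ≤ i + T, j ∉ E →
        enc j (fun l => s l) = enc j (fun l => s' l)) → s i = s' i) → c.Recovers E i := by
  classical
  -- Decode to any stream consistent with the received packets; `default` never occurs for an actual
  -- channel output.
  refine ⟨⟨enc, fun i y => if h : ∃ s : ℕ → S, ∀ (j : Fin (i + T + 1)) (x : X), y j = some x →
    enc j (fun l => s l) = x then h.choose i else default⟩, fun E i hdet s => ?_⟩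
  have hex : ∃ s' : ℕ → S, ∀ (j : Fin (i + T + 1)) (x : X),
      (if (j : ℕ) ∈ E then none else some (enc j (fun l => s l))) = some x →
        enc j (fun l => s' l) = x :=
    ⟨s, fun j x hx => by split_ifs at hx; exact Option.some.inj hx⟩
  have hchoose := hex.choose_spec
  refine (dif_pos hex).trans (hdet _ s fun j hj hjE => ?_)
  exact hchoose ⟨j, by omega⟩ _ (if_neg hjE)

/-- The layered encoder. -/
def layeredEncoder {F : Type} [Field F] {κ μ σ : ℕ} (H : ℕ → Fin (μ + σ) → ℕ → Fin κ → F) (Δ : ℕ)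
    (i : ℕ) (s : Fin (i + 1) → Fin (μ + κ) → F) : Fin (μ + κ + (μ + σ)) → F :=
  let v : ℕ → Fin κ → F := fun j c => if h : j < i + 1 then s ⟨j, h⟩ (Fin.natAdd μ c) else 0
  Fin.append (s (Fin.last i)) (Fin.append
    (fun a => (if Δ ≤ i then s ⟨i - Δ, by omega⟩ (Fin.castAdd κ a) else 0) +
      causalParity H v i (Fin.castAdd σ a))
    (fun a => causalParity H v i (Fin.natAdd μ a)))

/-- The encoder is linear, so unique decoding becomes a statement about the difference of two
indistinguishable streams. -/
theorem layeredSilent_of_encoder_eq {F : Type} [Field F] {κ μ σ : ℕ}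
    {H : ℕ → Fin (μ + σ) → ℕ → Fin κ → F} {Δ : ℕ} {E : Set ℕ} {s s' : ℕ → Fin (μ + κ) → F} {N : ℕ}
    (h : ∀ i ≤ N, i ∉ E →
      layeredEncoder H Δ i (fun l => s l) = layeredEncoder H Δ i (fun l => s' l)) :
    LayeredSilent H Δ E (fun i a => s i (Fin.castAdd κ a) - s' i (Fin.castAdd κ a))
      ((fun i c => s i (Fin.natAdd μ c)) - fun i c => s' i (Fin.natAdd μ c)) N := by
  intro i hi hiE
  have htrunc : ∀ (s : ℕ → Fin (μ + κ) → F) (a : Fin (μ + σ)), causalParity H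
      (fun j c => if j < i + 1 then s j (Fin.natAdd μ c) else 0) i a =
      causalParity H (fun j c => s j (Fin.natAdd μ c)) i a := by
    intro s a
    refine Finset.sum_congr rfl fun j hj => Finset.sum_congr rfl fun c _ => ?_
    exact congrArg _ (if_pos (Finset.mem_range.1 hj))
  have h0 := congrFun (h i hi hiE)
  have h1 : ∀ a, s i a = s' i a := fun a => by
    have := h0 (Fin.castAdd _ a)
    simpa only [layeredEncoder, Fin.append_left, Fin.val_last] using this
  refine ⟨funext fun a => sub_eq_zero.2 (h1 _), funext fun c => sub_eq_zero.2 (h1 _),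
    fun a => ?_, fun a => ?_⟩
  · have := h0 (Fin.natAdd _ (Fin.castAdd _ a))
    simp only [layeredEncoder, Fin.append_left, Fin.append_right, dite_eq_ite, htrunc] at this
    rw [causalParity_sub]
    split_ifs at this ⊢ <;> linear_combination this
  · have := h0 (Fin.natAdd _ (Fin.natAdd _ a))
    simp only [layeredEncoder, Fin.append_right, dite_eq_ite, htrunc] at this
    rw [causalParity_sub]
    linear_combination this

theorem exists_partialRecoveryCode {B T Δ κ μ σ : ℕ} (hBΔ : B < Δ) (hΔT : Δ < T)
    (h : (κ * (B + 1) ≤ (μ + σ) * (Δ - (B + 1)) ∧ κ ≤ (T - Δ + 1) * σ) ∨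
      (μ = 0 ∧ κ * (B + 1) ≤ σ * (T - B))) :
    ∃ (F : Type) (_ : Field F) (_ : Finite F),
      ∃ c : StreamingCode (Fin (μ + κ) → F) (Fin (μ + κ + (μ + σ)) → F) T,
        IsPartialRecoveryCode B c := by
  obtain ⟨p, hp, H, hH⟩ := exists_isWindowGeneric κ (μ + σ) (T + 1) (by omega)
  refine ⟨ZMod p, inferInstance, inferInstance, ?_⟩
  obtain ⟨c, hc⟩ := exists_streamingCode T (layeredEncoder H Δ)
  refine ⟨c, isPartialRecoveryCode_of_lossCondition hBΔ hΔT c fun E hE i hi =>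
    hc E i fun s s' hss => ?_⟩
  have hsil := layeredSilent_of_encoder_eq hss
  obtain ⟨hu, hv⟩ : (fun a => s i (Fin.castAdd κ a) - s' i (Fin.castAdd κ a)) = 0 ∧
      ((fun i c => s i (Fin.natAdd μ c)) - fun i c => s' i (Fin.natAdd μ c)) i = 0 := by
    rcases h with ⟨h1, h2⟩ | ⟨rfl, h1⟩
    · exact layered_recovery hH hBΔ hΔT h1 h2 hE hi hsil
    · refine parity_recovery hH ?_ hE (by omega) hsil
      rwa [zero_add, Nat.add_sub_add_right]
  funext a
  refine Fin.addCases (fun a => ?_) (fun a => ?_) a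
  · exact sub_eq_zero.1 (congrFun hu a)
  · exact sub_eq_zero.1 (congrFun hv a)

/-- Dimensions of a partial recovery code of rate `shiftRate B T Δ`. -/
theorem exists_code_dimensions {B T Δ : ℕ} (hBΔ : B < Δ) (hΔT : Δ < T) :
    ∃ κ μ σ : ℕ, μ + κ = Δ * (T - Δ) + (B + 1) ∧ μ + σ = (B + 1) * (T - Δ + 1) ∧
      ((κ * (B + 1) ≤ (μ + σ) * (Δ - (B + 1)) ∧ κ ≤ (T - Δ + 1) * σ) ∨
        (μ = 0 ∧ κ * (B + 1) ≤ σ * (T - B))) := by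
  obtain ⟨r, rfl⟩ : ∃ r, Δ = B + 1 + r := ⟨Δ - (B + 1), by omega⟩
  obtain ⟨d, rfl⟩ : ∃ d, T = B + 1 + r + d := ⟨T - (B + 1 + r), by omega⟩
  rw [Nat.add_sub_cancel_left, Nat.add_sub_cancel_left,
    show B + 1 + r + d - B = 1 + r + d by omega]
  -- With σ = r and κ = (d + 1) r both counts are equalities, and μ = (B + 1)(d + 1) - r must be
  -- nonnegative. Otherwise μ = 0, and the full window of T + 1 instants suffices.
  rcases le_total r ((B + 1) * (d + 1)) with h | h
  · obtain ⟨μ, hμ⟩ := Nat.exists_eq_add_of_le h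
    refine ⟨(d + 1) * r, μ, r, ?_, by linarith, Or.inl ⟨?_, le_rfl⟩⟩
    · linarith
    · rw [add_comm μ, ← hμ]
      exact le_of_eq (by ring)
  · refine ⟨(B + 1 + r) * d + (B + 1), 0, (B + 1) * (d + 1), by ring, by ring, Or.inr ⟨rfl, ?_⟩⟩
    obtain ⟨z, rfl⟩ := Nat.exists_eq_add_of_le h
    nlinarith [Nat.zero_le (z * (B + 1)), Nat.zero_le (d * d * (B + 1))]

theorem mainTheorem2 (B T : ℕ) (hT : B + 2 ≤ T) :
    ∃ (F : Type) (_ : Field F) (_ : Finite F) (k n : ℕ),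
      IsGreatest {r : ℚ | ∃ Δ : ℕ, B < Δ ∧ Δ < T ∧ r = shiftRate B T Δ} ((k : ℚ) / (n : ℚ)) ∧
      ∃ c : StreamingCode (Fin k → F) (Fin n → F) T, IsPartialRecoveryCode B c := by
  obtain ⟨Δ, hΔ, hmax⟩ := Finset.exists_max_image (Finset.Ioo B T) (shiftRate B T)
    ⟨B + 1, Finset.mem_Ioo.2 ⟨by omega, by omega⟩⟩
  obtain ⟨hBΔ, hΔT⟩ := Finset.mem_Ioo.1 hΔ
  obtain ⟨κ, μ, σ, hk, hn, hcond⟩ := exists_code_dimensions hBΔ hΔT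
  obtain ⟨F, hF, hfin, hcode⟩ := exists_partialRecoveryCode hBΔ hΔT hcond
  have hrate : ((μ + κ : ℕ) : ℚ) / ((μ + κ + (μ + σ) : ℕ) : ℚ) = shiftRate B T Δ := by
    rw [hk, hn, shiftRate]
    push_cast [Nat.cast_sub hΔT.le]
    congr 1
    ring
  refine ⟨F, hF, hfin, μ + κ, μ + κ + (μ + σ), ?_, hcode⟩
  rw [hrate]
  refine ⟨⟨Δ, hBΔ, hΔT, rfl⟩, ?_⟩
  rintro r ⟨Δ', h1, h2, rfl⟩
  exact hmax Δ' (Finset.mem_Ioo.2 ⟨h1, h2⟩)
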